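/- **Setting.** Let $\alpha\in(0,1]$, $k>0$, $\sigma_0>0$. An open connected set $D\subset\mathbb R^3$ is called *uniformly $C^{1,\alpha}$ with constants $k,\sigma_0$* if for every $x_0\in\partial D$ there is an isometry $\mathcal R$ of $\mathbb R^3$ with $\mathcal R(0)=x_0$ such that the image under $\mathcal R$ of $$\{x:\ |x'|<\sigma_0,\ k|x'|^{1+\alpha}<|x_3|<k\sigma_0^{1+\alpha}\},\qquad x'=(x_1,x_2),$$ does not meet $\partial D$, the image of its part with $x_3>0$ lies in $D$, and the image of its part with $x_3<0$ lies outside $D$. Let $\Omega\subset\mathbb R^3$ be a domain, let $S\subset\Omega$ be a bounded domain, both uniformly $C^{1,\alpha}$ with constants $k,\sigma_0$, and put $F=\Omega\setminus\overline S$, $H=\operatorname{diam}S$ and $h=\operatorname{dist}(S,\partial\Omega)$. Let $P\in\partial S$, $Q\in\partial\Omega$ be points with $|PQ|=h$, and use Cartesian coordinates $(x_1,x_2,x_3)$ with origin $Q$, in which $P=(0,0,h)$ and the $x_3$-axis points along the inner normals to $\partial\Omega$ at $Q$ and to $\partial S$ at $P$ (for $h>0$ this is the direction of $P-Q$). For $\sigma\ge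 0$ let $$\mathcal C_\sigma=\{0<|x'|<\sigma,\ -k\sigma^{1+\alpha}<x_3<h+2k\sigma^{1+\alpha}\}.$$ For $1\le p<\infty$ let $W^{1,p}_0(S,\Omega)$ be the set of $\boldsymbol u\in W^{1,p}_0(\Omega;\mathbb R^3)$ (the closure of $C_c^\infty(\Omega;\mathbb R^3)$ in $W^{1,p}$) for which there are $\boldsymbol u_*,\boldsymbol\omega\in\mathbb R^3$ with $\boldsymbol u(x)=\boldsymbol u_*+\boldsymbol\omega\times(x-x_*)$ for a.e. $x\in S$, where $x_*\in\overline S$ is a fixed point. Such a $\boldsymbol u$ is extended by zero outside $\Omega$, and $|\nabla\boldsymbol u|$ is the Euclidean (Frobenius) norm of its weak gradient. **Lemma.** Given $\alpha\in(0,1]$, $k,\sigma_0,H>0$ and $p\in[1,\infty)$, there exist constants $0<H_*\le H$ and $0<\sigma_*\le\sigma_0/2$, depending only on $\alpha,k,\sigma_0,H,p$, such that for all $\Omega$, $S$ (with $\operatorname{diam}S=H$), all coordinates as above and all $\boldsymbol u\in W^{1,p}_0(S,\Omega)$ with $\operatorname{div}\boldsymbol u=0$: if $$h\le H_*\qquad\text{and}\qquad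 \frac{\sigma_0}{2}\Big(\frac hH\Big)^{\frac1{1+\alpha}}\le\sigma\le\sigma_*,$$ then $$\int_{\mathcal C_\sigma}|\nabla\boldsymbol u|^p\,dx\ \le\ 2\int_{\mathcal C_\sigma\cap F}|\nabla\boldsymbol u|^p\,dx .$$ -/

import Mathlib

open MeasureTheory

noncomputable section

/-- Euclidean three-space. -/
abbrev E3 : Type := EuclideanSpace ℝ (Fin 3)

/-- Real 3 × 3 arrays with the Euclidean (Frobenius) norm. -/
abbrev M3 : Type := EuclideanSpace ℝ (Fin 3 × Fin 3)

/-- A domain: a nonempty connected open set. -/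
def IsOpenDomain (D : Set E3) : Prop := IsOpen D ∧ IsConnected D

/-- `|x'|` for `x' = (x₁, x₂)`. -/
def planarNorm (x : E3) : ℝ := Real.sqrt (x 0 ^ 2 + x 1 ^ 2)

/-- The point `(0, 0, t)` on the `x₃`-axis. -/
def axisPoint (t : ℝ) : E3 := EuclideanSpace.single 2 t

/-- The distance between two sets: the infimum of the distances of their points. -/
def setDist (A B : Set E3) : ℝ := sInf {d : ℝ | ∃ a ∈ A, ∃ b ∈ B, d = dist a b}

/-- `D` is uniformly `C^{1,α}` with constants `k` and `σ₀`: at each boundary point there are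
Cartesian coordinates centred there (given by an isometry `R`) in which `∂D` misses the set
`k|x'|^{1+α} < |x₃| < kσ₀^{1+α}`, `|x'| < σ₀`, and `D` lies locally on one side of its boundary,
that is, the part of that set with `x₃ > 0` is inside `D` and the part with `x₃ < 0` is outside. -/
def IsUniformlyC1 (α k σ₀ : ℝ) (D : Set E3) : Prop :=
  ∀ x₀ ∈ frontier D, ∃ R : E3 ≃ᵢ E3, R 0 = x₀ ∧
    ∀ x : E3, planarNorm x < σ₀ →
      k * planarNorm x ^ (1 + α) < |x 2| → |x 2| < k * σ₀ ^ (1 + α) →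
        R x ∉ frontier D ∧ (0 < x 2 → R x ∈ D) ∧ (x 2 < 0 → R x ∉ D)

/-- The unit vector `ν` is the inner normal of `D` at the point `x`: near `x`, every cone of
aperture less than that of a half-space about `ν` lies in `D`, and about `-ν` lies outside `D`. -/
def IsInnerNormal (D : Set E3) (x ν : E3) : Prop :=
  ‖ν‖ = 1 ∧ ∀ ε > (0 : ℝ), ∃ δ > (0 : ℝ), ∀ y : E3, ‖y - x‖ < δ →
    (ε * ‖y - x‖ < inner ℝ (y - x) ν → y ∈ D) ∧
    (inner ℝ (y - x) ν < -(ε * ‖y - x‖) → y ∉ D)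

/-- `R` is the orthogonal coordinate system `(x₁, x₂, x₃)` attached to a pair of nearest points
`P ∈ ∂S`, `Q ∈ ∂Ω`: its origin is `Q`, the point `P` has coordinates `(0, 0, h)` with
`h = dist(S, ∂Ω)`, and the `x₃`-axis is normal to `∂Ω` at `Q` and to `∂S` at `P`, that is, the
planes `x₃ = 0` and `x₃ = h` are the tangent planes there. -/
structure IsGapFrame (Ω S : Set E3) (P Q : E3) (R : E3 ≃ᵢ E3) : Prop where
  mem_P : P ∈ frontier S
  mem_Q : Q ∈ frontier Ω
  origin : R 0 = Q
  top : R (axisPoint (setDist S (frontier Ω))) = P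
  normal_Q : IsInnerNormal Ω Q (R (axisPoint 1) - R 0)
  normal_P : IsInnerNormal S P (R (axisPoint 1) - R 0)

/-- The cylinder `0 < r < σ`, `-kσ^{1+α} < x₃ < h + 2kσ^{1+α}`, in the coordinates of `R`. -/
def gapCylinder (R : E3 ≃ᵢ E3) (α k h σ : ℝ) : Set E3 :=
  R '' {x : E3 | 0 < planarNorm x ∧ planarNorm x < σ ∧
    -(k * σ ^ (1 + α)) < x 2 ∧ x 2 < h + 2 * (k * σ ^ (1 + α))}

/-- The classical gradient `(∂ⱼφᵢ)ᵢⱼ` of a vector field. -/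
def classicalGrad (φ : E3 → E3) (x : E3) : M3 :=
  WithLp.toLp 2 fun ij => (fderiv ℝ φ x (EuclideanSpace.single ij.2 1)) ij.1

/-- Test functions on `Ω`, with values in a normed space. -/
def IsTestFunction {V : Type} [NormedAddCommGroup V] [NormedSpace ℝ V]
    (Ω : Set E3) (φ : E3 → V) : Prop :=
  ContDiff ℝ (⊤ : ℕ∞) φ ∧ HasCompactSupport φ ∧ tsupport φ ⊆ Ω

/-- `G = (∂ⱼuᵢ)ᵢⱼ` is the weak gradient of `u` on `Ω`. -/
def IsWeakGrad (Ω : Set E3) (u : E3 → E3) (G : E3 → M3) : Prop :=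
  ∀ φ : E3 → ℝ, IsTestFunction Ω φ → ∀ i j : Fin 3,
    ∫ x in Ω, u x i * fderiv ℝ φ x (EuclideanSpace.single j 1) = -∫ x in Ω, G x (i, j) * φ x

/-- `u ∈ W^{1,p}(Ω; ℝ³)` with weak gradient `G`. -/
structure MemW1 (p : ℝ) (Ω : Set E3) (u : E3 → E3) (G : E3 → M3) : Prop where
  memLp : MemLp u (ENNReal.ofReal p) (volume.restrict Ω)
  memLp_grad : MemLp G (ENNReal.ofReal p) (volume.restrict Ω)
  weakGrad : IsWeakGrad Ω u G

/-- `u ∈ W₀^{1,p}(Ω; ℝ³)` with weak gradient `G`: `u` lies in the closure of the test fields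
in the norm of `W^{1,p}(Ω; ℝ³)`. -/
structure MemW10 (p : ℝ) (Ω : Set E3) (u : E3 → E3) (G : E3 → M3) : Prop
    extends MemW1 p Ω u G where
  approx : ∀ ε > (0 : ENNReal), ∃ φ : E3 → E3, IsTestFunction Ω φ ∧
    eLpNorm (fun x => u x - φ x) (ENNReal.ofReal p) (volume.restrict Ω) < ε ∧
    eLpNorm (fun x => G x - classicalGrad φ x) (ENNReal.ofReal p) (volume.restrict Ω) < ε

/-- `u ∈ W₀^{1,p}(S, Ω)` with weak gradient `G`: moreover `u` is a rigid velocity field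
`u(x) = a + ω × (x - x⋆)` in `S`, where `x⋆` is a point of the closure of `S`. -/
structure MemRigidW10 (p : ℝ) (S Ω : Set E3) (u : E3 → E3) (G : E3 → M3) : Prop
    extends MemW10 p Ω u G where
  rigid : ∃ xs ∈ closure S, ∃ a ω : Fin 3 → ℝ, ∀ᵐ x ∂(volume.restrict S),
    u x = WithLp.toLp 2 (a + crossProduct ω (WithLp.ofLp (x - xs)))

/-- `div u = 0` in `Ω`, where `G` is the weak gradient of `u`. -/
def IsDivFree (Ω : Set E3) (G : E3 → M3) : Prop :=
  ∀ᵐ x ∂(volume.restrict Ω), ∑ i : Fin 3, G x (i, i) = 0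

end

/-! In the solid the gradient is a constant skew matrix `g` with `‖g‖ ≤ 2‖ω‖`, so the task is to
bound `ω` by the gradient over the thin cylinder. Write `τ = kσ^{1+α}`. A box of sides `σ/2, σ/2, τ`
sits inside `S` at heights between `h + τ` and `h + 2τ`, and moving it down the axis by `h + 3τ`
puts it outside `Ω`, where `u` vanishes. A one-dimensional Poincaré inequality bounds the mean of
`u` over the box (`MemW10.lintegral_enorm_le`), while horizontal differences of a rigid field
recover `ω` from that mean (`enorm_angular_mul_le`). Together, in `IsGapFrame.angular_le`, they
bound `‖ω‖ σ³τ` by a multiple of `(h + 3τ) ∫ ‖G‖`.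

The lower bound on `σ` says `h ≤ Mτ`, hence `‖g‖ ≤ c ∫ ‖G‖` with `c` of order `σ⁻³`. The cylinder
has volume at most `V` of order `σ²τ`, so `cV` is of order `σ^α` and is at most `1/2` for small `σ`.
The solid's share of `∫ ‖G‖` can then be absorbed, leaving `‖g‖V ≤ ∫ ‖G‖` over the fluid part.
Jensen's inequality raises this to the power `p` with no loss, so the factor 2 holds with thresholds
independent of `p` (`setIntegral_rpow_le_two_mul`). -/

/-! ### Local frames of a `C^{1,α}` domain. -/

lemma IsometryEquiv.exists_linearIsometryEquiv (R : E3 ≃ᵢ E3) :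
    ∃ L : E3 ≃ₗᵢ[ℝ] E3, ∀ x, R x = L x + R 0 := by
  refine ⟨R.toRealAffineIsometryEquiv.linearIsometryEquiv, fun x => ?_⟩
  have h := R.toRealAffineIsometryEquiv.map_vadd 0 x
  have h2 : ∀ y, R.toRealAffineIsometryEquiv y = R y := fun y => by
    conv_rhs => rw [← IsometryEquiv.coe_toRealAffineIsometryEquiv R]
    rfl
  simpa [h2] using h

lemma inner_axisPoint (x : E3) : inner ℝ x (axisPoint 1) = x 2 := by
  simp [axisPoint, EuclideanSpace.inner_single_right]

lemma norm_axisPoint (t : ℝ) : ‖axisPoint t‖ = |t| := by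
  simp [axisPoint]

lemma planarNorm_eq (x : E3) : planarNorm x = Real.sqrt (‖x‖ ^ 2 - x 2 ^ 2) := by
  rw [planarNorm, EuclideanSpace.norm_sq_eq]
  congr 1
  simp [Fin.sum_univ_three]

lemma planarNorm_nonneg (x : E3) : 0 ≤ planarNorm x := Real.sqrt_nonneg _

lemma planarNorm_le_norm (x : E3) : planarNorm x ≤ ‖x‖ := by
  rw [planarNorm_eq]
  exact Real.sqrt_le_iff.2 ⟨norm_nonneg _, by nlinarith [sq_nonneg (x 2)]⟩

lemma inner_map_axisPoint (L : E3 ≃ₗᵢ[ℝ] E3) (x : E3) :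
    inner ℝ (L x) (L (axisPoint 1)) = x 2 := by
  rw [LinearIsometryEquiv.inner_map_map, inner_axisPoint]

lemma eventually_mul_rpow_lt {α : ℝ} (hα : 0 < α) (k : ℝ) {c : ℝ} (hc : 0 < c) :
    ∀ᶠ t in nhdsWithin (0 : ℝ) (Set.Ioi 0), k * t ^ (1 + α) < c * t := by
  have h1 : Filter.Tendsto (fun t : ℝ => k * t ^ α) (nhdsWithin 0 (Set.Ioi 0)) (nhds 0) := by
    have : ContinuousAt (fun t : ℝ => k * t ^ α) 0 :=
      continuousAt_const.mul (Real.continuousAt_rpow_const _ _ (Or.inr hα.le))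
    have h := this.tendsto
    simp only [Real.zero_rpow hα.ne', mul_zero] at h
    exact h.mono_left nhdsWithin_le_nhds
  filter_upwards [h1.eventually (gt_mem_nhds hc), self_mem_nhdsWithin] with t ht ht0
  have ht0 : 0 < t := ht0
  rw [Real.rpow_add ht0, Real.rpow_one]
  nlinarith

lemma eventually_nhdsGT_lt {a : ℝ} (ha : 0 < a) :
    ∀ᶠ t in nhdsWithin (0 : ℝ) (Set.Ioi 0), t < a :=
  (gt_mem_nhds ha).filter_mono nhdsWithin_le_nhds

/-- The normal of a uniformly `C^{1,α}` domain in the sense of `IsInnerNormal` is the third axis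
of every local frame as in the definition of `IsUniformlyC1`. -/
lemma IsInnerNormal.eq_axis {α k σ₀ : ℝ} (hα : 0 < α) (hk : 0 < k) (hσ₀ : 0 < σ₀) {D : Set E3}
    {x₀ ν : E3} (hν : IsInnerNormal D x₀ ν) (L : E3 ≃ₗᵢ[ℝ] E3)
    (hL : ∀ x : E3, planarNorm x < σ₀ → k * planarNorm x ^ (1 + α) < |x 2| →
      |x 2| < k * σ₀ ^ (1 + α) → 0 < x 2 → L x + x₀ ∈ D) :
    ν = L (axisPoint 1) := by
  by_contra hne
  have hn : ‖L (axisPoint 1)‖ = 1 := by simp [norm_axisPoint]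
  set ν' := L (axisPoint 1) with hν'
  have hc := (inner_lt_one_iff_real_of_norm_eq_one hν.1 hn).2 hne
  set c := 1 - inner ℝ ν ν' with hcdef
  have hc0 : 0 < c := by linarith
  obtain ⟨δ, hδ, hD⟩ := hν.2 (c / 4) (by linarith)
  have hM : 0 < k * σ₀ ^ (1 + α) := by positivity
  obtain ⟨s, hs1, hs2, hs3, hs4, hs0⟩ := ((eventually_mul_rpow_lt hα k (half_pos hc0)).and
    ((eventually_nhdsGT_lt hσ₀).and ((eventually_nhdsGT_lt hδ).and
    ((eventually_nhdsGT_lt (a := 2 * (k * σ₀ ^ (1 + α)) / c) (by positivity)).and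
      self_mem_nhdsWithin)))).exists
  have hs0 : 0 < s := hs0
  -- Two distinct unit normals are separated by the direction `w`: it makes a positive product with
  -- `ν'` and a negative one with `ν`. A short step along `w` would therefore be both inside and
  -- outside `D`.
  set w := ν' - ν with hw
  have hw2 : ‖w‖ ≤ 2 := (norm_sub_le _ _).trans (by rw [hn, hν.1]; norm_num)
  have hwν : inner ℝ w ν = -c := by
    rw [hw, inner_sub_left, real_inner_self_eq_norm_sq, hν.1, real_inner_comm]
    linarith
  have hwν' : inner ℝ w ν' = c := by
    rw [hw, inner_sub_left, real_inner_self_eq_norm_sq, hn]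
    linarith
  set x := L.symm ((s / 2) • w) with hx
  have hLx : L x = (s / 2) • w := by simp [hx]
  have hx2 : x 2 = s / 2 * c := by
    rw [← inner_map_axisPoint L, hLx, inner_smul_left, ← hν', hwν']
    simp
  have hxn : ‖x‖ = s / 2 * ‖w‖ := by
    rw [hx, LinearIsometryEquiv.norm_map, norm_smul, Real.norm_of_nonneg (by linarith)]
  have hxs : ‖x‖ ≤ s := by nlinarith
  have hp := (planarNorm_le_norm x).trans hxs
  have hx2p : 0 < x 2 := by rw [hx2]; positivity
  have hin : L x + x₀ ∈ D := by
    refine hL x (hp.trans_lt hs2) ?_ ?_ hx2p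
    · rw [abs_of_pos hx2p, hx2]
      refine lt_of_le_of_lt ?_ (hs1.trans_eq (by ring))
      have := planarNorm_nonneg x
      gcongr
    · rw [abs_of_pos hx2p, hx2]
      rw [lt_div_iff₀ hc0] at hs4
      linarith
  have hout := (hD (L x + x₀) (by
    rw [add_sub_cancel_right, LinearIsometryEquiv.norm_map]; exact hxs.trans_lt hs3)).2
  refine hout ?_ hin
  rw [add_sub_cancel_right, LinearIsometryEquiv.norm_map, hLx, inner_smul_left, hwν]
  simp only [conj_trivial]
  nlinarith

/-- The local description of a uniformly `C^{1,α}` domain holds in every frame whose third axis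
is the inner normal. -/
lemma IsUniformlyC1.mem_iff_of_innerNormal {α k σ₀ : ℝ} (hα : 0 < α) (hk : 0 < k) (hσ₀ : 0 < σ₀)
    {D : Set E3} (hD : IsUniformlyC1 α k σ₀ D) {x₀ : E3} (hx₀ : x₀ ∈ frontier D)
    (L : E3 ≃ₗᵢ[ℝ] E3) (hν : IsInnerNormal D x₀ (L (axisPoint 1))) (x : E3)
    (h1 : planarNorm x < σ₀) (h2 : k * planarNorm x ^ (1 + α) < |x 2|)
    (h3 : |x 2| < k * σ₀ ^ (1 + α)) :
    (0 < x 2 → L x + x₀ ∈ D) ∧ (x 2 < 0 → L x + x₀ ∉ D) := by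
  obtain ⟨R, hR0, hR⟩ := hD x₀ hx₀
  obtain ⟨L', hL'⟩ := R.exists_linearIsometryEquiv
  rw [hR0] at hL'
  have hax : L (axisPoint 1) = L' (axisPoint 1) :=
    hν.eq_axis hα hk hσ₀ L' fun y hy1 hy2 hy3 hy4 => hL' y ▸ (hR y hy1 hy2 hy3).2.1 hy4
  -- The two frames share their third axis, so passing between them preserves `x₃` and `|x'|`, the
  -- only quantities in the local description.
  set y := L'.symm (L x) with hy
  have hy' : L' y = L x := by simp [hy]
  have hy2 : y 2 = x 2 := by
    rw [← inner_map_axisPoint L', hy', ← hax, inner_map_axisPoint]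
  have hyp : planarNorm y = planarNorm x := by
    rw [planarNorm_eq, planarNorm_eq, hy2, hy]
    simp
  have h := hR y (by rwa [hyp]) (by rwa [hyp, hy2]) (by rwa [hy2])
  rw [hL', hy', hy2] at h
  exact h.2

/-! ### The boundary is a null set. -/

/-- By Lebesgue density: around any boundary point, each small ball of radius `r` contains a ball of
radius `r/4`, centred on the local axis, that misses the boundary. So no boundary point has density
1. -/
lemma volume_frontier_eq_zero {α k σ₀ : ℝ} (hα : 0 < α) (hk : 0 < k) (hσ₀ : 0 < σ₀)
    {D : Set E3} (hD : IsUniformlyC1 α k σ₀ D) : volume (frontier D) = 0 := by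
  have hae := Besicovitch.ae_tendsto_measure_inter_div_of_measurableSet (volume : Measure E3)
    (isClosed_frontier (s := D)).measurableSet
  rw [measure_eq_zero_iff_ae_notMem]
  filter_upwards [hae] with x₀ hx hmem
  rw [Set.indicator_of_mem hmem, Pi.one_apply] at hx
  obtain ⟨R, hR0, hR⟩ := hD x₀ hmem
  have hM : 0 < k * σ₀ ^ (1 + α) := by positivity
  -- The ball of radius `r/4` has `1/64` of the volume of the ball of radius `r`.
  have hb : ENNReal.ofReal (1 - 1 / 64) < 1 := by
    rw [← ENNReal.ofReal_one]
    exact (ENNReal.ofReal_lt_ofReal_iff one_pos).2 (by norm_num)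
  obtain ⟨r, hr1, hr2, hr3, hr4, hr0⟩ := ((hx.eventually (lt_mem_nhds hb)).and
    ((eventually_mul_rpow_lt hα k (c := 1 / 4) (by norm_num)).and
    ((eventually_nhdsGT_lt hσ₀).and ((eventually_nhdsGT_lt hM).and self_mem_nhdsWithin)))).exists
  have hr0 : 0 < r := hr0
  set z := R (axisPoint (r / 2)) with hz
  have hsub : Metric.closedBall z (r / 4 ) ⊆ Metric.closedBall x₀ r := by
    refine Metric.closedBall_subset_closedBall' ?_
    rw [hz, ← hR0, R.isometry.dist_eq, dist_zero_right, norm_axisPoint, abs_of_pos (by linarith)]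
    linarith
  have hsub2 : frontier D ∩ Metric.closedBall x₀ r ⊆
      Metric.closedBall x₀ r \ Metric.closedBall z (r / 4 ) := by
    refine fun y hy => ⟨hy.2, fun hyz => ?_⟩
    obtain ⟨x, rfl⟩ := R.surjective y
    rw [hz, Metric.mem_closedBall, R.isometry.dist_eq, dist_eq_norm] at hyz
    have h2 : |x 2 - r / 2| ≤ r / 4 := by
      refine le_trans ?_ hyz
      have h := PiLp.norm_apply_le (x - axisPoint (r / 2)) 2
      simpa [axisPoint] using h
    have hp : planarNorm x ≤ r / 4 := by
      refine le_trans (le_of_eq_of_le ?_ (planarNorm_le_norm (x - axisPoint (r / 2)))) hyz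
      simp [planarNorm, axisPoint]
    rw [abs_le] at h2
    have hx2 : 0 < x 2 := by linarith
    refine (hR x (by linarith) ?_ ?_).1 hy.1
    · rw [abs_of_pos hx2]
      have : k * planarNorm x ^ (1 + α) ≤ k * r ^ (1 + α) := by
        have := planarNorm_nonneg x
        gcongr
        linarith
      linarith
    · rw [abs_of_pos hx2]; linarith
  have hle := measure_mono (μ := volume) hsub2
  rw [measure_sdiff hsub Metric.isClosed_closedBall.measurableSet.nullMeasurableSet
    measure_closedBall_lt_top.ne, Measure.addHaar_closedBall _ z (by linarith),
    Measure.addHaar_closedBall _ x₀ hr0.le, ← ENNReal.sub_mul (by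
      intro _ _; exact measure_ball_lt_top.ne), ← ENNReal.ofReal_sub _ (by positivity)] at hle
  refine hr1.not_ge (ENNReal.div_le_of_le_mul (hle.trans ?_))
  rw [Measure.addHaar_closedBall _ x₀ hr0.le, ← mul_assoc, ← ENNReal.ofReal_mul (by norm_num)]
  refine le_of_eq ?_
  congr 2
  simp only [finrank_euclideanSpace, Fintype.card_fin]
  ring

/-! ### Poincaré inequality along a direction leaving `Ω`. -/

lemma norm_fderiv_le_classicalGrad (φ : E3 → E3) (x v : E3) :
    ‖fderiv ℝ φ x v‖ ≤ ‖classicalGrad φ x‖ * ‖v‖ := by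
  have hv : v = ∑ j, v j • EuclideanSpace.single j (1 : ℝ) := by
    ext i
    fin_cases i <;> simp [Fin.sum_univ_three]
  have hi : ∀ i, (fderiv ℝ φ x v) i = ∑ j, classicalGrad φ x (i, j) * v j := by
    intro i
    conv_lhs => rw [hv]
    simp [classicalGrad, Fin.sum_univ_three, mul_comm]
  rw [← sq_le_sq₀ (norm_nonneg _) (by positivity), mul_pow, EuclideanSpace.norm_sq_eq,
    EuclideanSpace.norm_sq_eq, EuclideanSpace.norm_sq_eq, Fintype.sum_prod_type, Finset.sum_mul]
  refine Finset.sum_le_sum fun i _ => ?_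
  simp only [Real.norm_eq_abs, sq_abs]
  rw [hi]
  exact Finset.sum_mul_sq_le_sq_mul_sq _ _ _

lemma IsTestFunction.continuous_classicalGrad {Ω : Set E3} {φ : E3 → E3}
    (hφ : IsTestFunction Ω φ) : Continuous (classicalGrad φ) := by
  have h : Continuous (fderiv ℝ φ) := hφ.1.continuous_fderiv (by simp)
  unfold classicalGrad
  refine (PiLp.continuous_toLp 2 _).comp (continuous_pi fun ij => ?_)
  exact (EuclideanSpace.proj ij.1).continuous.comp (h.clm_apply continuous_const)

lemma classicalGrad_eq_zero {φ : E3 → E3} {x : E3} (hx : x ∉ tsupport φ) :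
    classicalGrad φ x = 0 := by
  have h : fderiv ℝ φ x = 0 := by
    by_contra h
    exact hx (support_fderiv_subset ℝ h)
  ext ij
  simp [classicalGrad, h]

lemma enorm_le_lintegral_classicalGrad {φ : E3 → E3} {Ω : Set E3} (hφ : IsTestFunction Ω φ)
    {ν x : E3} (hν : ‖ν‖ ≤ 1) {l : ℝ} (hl : 0 ≤ l) (hx : x - l • ν ∉ Ω) :
    ‖φ x‖ₑ ≤ ∫⁻ s in Set.Ioc 0 l, ‖classicalGrad φ (x - s • ν)‖ₑ := by
  have hd : Differentiable ℝ φ := hφ.1.differentiable (by simp)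
  have h0 : φ (x - l • ν) = 0 := image_eq_zero_of_notMem_tsupport fun h => hx (hφ.2.2 h)
  have hc : Continuous fun s : ℝ => fderiv ℝ φ (x - s • ν) (-ν) :=
    ((hφ.1.continuous_fderiv (by simp)).comp (by fun_prop)).clm_apply continuous_const
  have hF : ∫ s in (0 : ℝ)..l, fderiv ℝ φ (x - s • ν) (-ν) = φ (x - l • ν) - φ (x - (0 : ℝ) • ν) := by
    refine intervalIntegral.integral_eq_sub_of_hasDerivAt (f := fun s : ℝ => φ (x - s • ν))
      (fun s _ => ?_) (hc.intervalIntegrable _ _)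
    have h1 : HasDerivAt (fun s : ℝ => x - s • ν) (-ν) s := by
      simpa using ((hasDerivAt_id s).smul_const ν).const_sub x
    exact (hd _).hasFDerivAt.comp_hasDerivAt s h1
  rw [h0, zero_smul, sub_zero, zero_sub, intervalIntegral.integral_of_le hl] at hF
  rw [← enorm_neg, ← hF]
  refine (enorm_integral_le_lintegral_enorm _).trans (lintegral_mono fun s => ?_)
  rw [← ofReal_norm, ← ofReal_norm]
  refine ENNReal.ofReal_le_ofReal ((norm_fderiv_le_classicalGrad _ _ _).trans ?_)
  rw [norm_neg]
  exact mul_le_of_le_one_right (norm_nonneg _) hν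

/-- Poincaré inequality for test fields, in a set whose translate by `-l • ν` lies outside `Ω`. -/
lemma lintegral_enorm_testFunction_le {φ : E3 → E3} {Ω C W : Set E3} (hφ : IsTestFunction Ω φ)
    (hΩ : MeasurableSet Ω) (hC : MeasurableSet C) (hW : MeasurableSet W)
    {ν : E3} (hν : ‖ν‖ ≤ 1) {l : ℝ} (hl : 0 ≤ l) (h1 : ∀ x ∈ W, x - l • ν ∉ Ω)
    (h2 : ∀ x ∈ W, ∀ s ∈ Set.Ioc 0 l, x - s • ν ∈ Ω → x - s • ν ∈ C) :
    ∫⁻ x in W, ‖φ x‖ₑ ≤ ENNReal.ofReal l * ∫⁻ x in C ∩ Ω, ‖classicalGrad φ x‖ₑ := by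
  have hg := hφ.continuous_classicalGrad
  calc ∫⁻ x in W, ‖φ x‖ₑ
      ≤ ∫⁻ x in W, ∫⁻ s in Set.Ioc 0 l, ‖classicalGrad φ (x - s • ν)‖ₑ :=
        setLIntegral_mono_ae (by fun_prop) (.of_forall fun x hx =>
          enorm_le_lintegral_classicalGrad hφ hν hl (h1 x hx))
    _ = ∫⁻ s in Set.Ioc 0 l, ∫⁻ x in W, ‖classicalGrad φ (x - s • ν)‖ₑ := by
        refine lintegral_lintegral_swap (Continuous.aemeasurable ?_)
        exact (hg.comp (by fun_prop : Continuous fun q : E3 × ℝ => q.1 - q.2 • ν)).enorm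
    _ ≤ ∫⁻ s in Set.Ioc 0 l, ∫⁻ x in C ∩ Ω, ‖classicalGrad φ x‖ₑ := by
        refine setLIntegral_mono_ae (by fun_prop) (.of_forall fun s hs => ?_)
        rw [← lintegral_indicator hW, ← lintegral_indicator (hC.inter hΩ),
          ← lintegral_sub_right_eq_self ((C ∩ Ω).indicator _) (s • ν)]
        refine lintegral_mono fun x => Set.indicator_apply_le (g := fun x =>
          (C ∩ Ω).indicator (fun x => ‖classicalGrad φ x‖ₑ) (x - s • ν)) fun hx => ?_
        -- The segment may leave `C` once it is outside `Ω`, because the gradient of the test field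
        -- vanishes there.
        by_cases hm : x - s • ν ∈ Ω
        · rw [Set.indicator_of_mem (show x - s • ν ∈ C ∩ Ω from ⟨h2 x hx s hs hm, hm⟩)]
        · rw [classicalGrad_eq_zero fun h => hm (hφ.2.2 h)]
          simp
    _ = ENNReal.ofReal l * ∫⁻ x in C ∩ Ω, ‖classicalGrad φ x‖ₑ := by
        rw [setLIntegral_const, Real.volume_Ioc, sub_zero, mul_comm]

lemma setLIntegral_enorm_le_eLpNorm {F : Type} [NormedAddCommGroup F] {f : E3 → F}
    {A Ω : Set E3} (hA : A ⊆ Ω) {q : ENNReal} (hq : 1 ≤ q)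
    (hf : AEStronglyMeasurable f (volume.restrict Ω)) :
    ∫⁻ x in A, ‖f x‖ₑ ≤
      eLpNorm f q (volume.restrict Ω) * volume A ^ (1 - 1 / q.toReal) := by
  rw [← eLpNorm_one_eq_lintegral_enorm]
  have hr : volume.restrict A ≤ volume.restrict Ω := Measure.restrict_mono hA le_rfl
  refine (eLpNorm_le_eLpNorm_mul_rpow_measure_univ hq (hf.mono_measure hr)).trans ?_
  rw [Measure.restrict_apply_univ, ENNReal.toReal_one, div_one]
  gcongr

/-- Poincaré inequality for fields in `W₀^{1,p}(Ω)`, in a set whose translate by `-l • ν` lies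
outside `Ω`. -/
lemma MemW10.lintegral_enorm_le {p : ℝ} (hp : 1 ≤ p) {u : E3 → E3} {G : E3 → M3}
    {Ω C W : Set E3} (hu : MemW10 p Ω u G)
    (hΩ : MeasurableSet Ω) (hC : MeasurableSet C) (hW : MeasurableSet W) (hWΩ : W ⊆ Ω)
    (hCfin : volume C ≠ ⊤) (hWfin : volume W ≠ ⊤)
    {ν : E3} (hν : ‖ν‖ ≤ 1) {l : ℝ} (hl : 0 ≤ l) (h1 : ∀ x ∈ W, x - l • ν ∉ Ω)
    (h2 : ∀ x ∈ W, ∀ s ∈ Set.Ioc 0 l, x - s • ν ∈ Ω → x - s • ν ∈ C) :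
    ∫⁻ x in W, ‖u x‖ₑ ≤ ENNReal.ofReal l * ∫⁻ x in C ∩ Ω, ‖G x‖ₑ := by
  set q := ENNReal.ofReal p with hqdef
  have hq : 1 ≤ q := by
    rw [hqdef, ← ENNReal.ofReal_one]; exact ENNReal.ofReal_le_ofReal hp
  have he : 0 ≤ 1 - 1 / q.toReal := by
    rw [hqdef, ENNReal.toReal_ofReal (by linarith), sub_nonneg, div_le_one (by linarith)]
    exact hp
  set a := volume W ^ (1 - 1 / q.toReal) with ha
  set b := volume (C ∩ Ω) ^ (1 - 1 / q.toReal) with hb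
  have haf : a ≠ ⊤ := ENNReal.rpow_ne_top_of_nonneg he hWfin
  have hbf : b ≠ ⊤ := ENNReal.rpow_ne_top_of_nonneg he
    (ne_top_of_le_ne_top hCfin (measure_mono Set.inter_subset_left))
  set K := a + ENNReal.ofReal l * b with hK
  have hKf : K ≠ ⊤ := by finiteness
  have key : ∀ ε > (0 : ENNReal),
      ∫⁻ x in W, ‖u x‖ₑ ≤ ENNReal.ofReal l * (∫⁻ x in C ∩ Ω, ‖G x‖ₑ) + ε * K := by
    intro ε hε
    obtain ⟨φ, hφ, hφ1, hφ2⟩ := hu.approx ε hε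
    have hg := hφ.continuous_classicalGrad
    have hc : Continuous φ := hφ.1.continuous
    have hum := hu.memLp.aestronglyMeasurable
    have hGm := hu.memLp_grad.aestronglyMeasurable
    have e1 := (setLIntegral_enorm_le_eLpNorm hWΩ hq
      (hum.sub hc.aestronglyMeasurable)).trans (mul_le_mul_left hφ1.le a)
    have e2 := (setLIntegral_enorm_le_eLpNorm (Set.inter_subset_right (s := C)) hq
      (hGm.sub hg.aestronglyMeasurable)).trans (mul_le_mul_left hφ2.le b)
    have e3 := lintegral_enorm_testFunction_le hφ hΩ hC hW hν hl h1 h2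
    have e4 : ∫⁻ x in W, ‖u x‖ₑ ≤ (∫⁻ x in W, ‖φ x‖ₑ) + ∫⁻ x in W, ‖(u - φ) x‖ₑ := by
      rw [← lintegral_add_left (by fun_prop)]
      refine lintegral_mono fun x => ?_
      calc ‖u x‖ₑ = ‖φ x + (u x - φ x)‖ₑ := by congr 1; abel
        _ ≤ _ := enorm_add_le _ _
    have e5 : ∫⁻ x in C ∩ Ω, ‖classicalGrad φ x‖ₑ ≤
        (∫⁻ x in C ∩ Ω, ‖G x‖ₑ) + ∫⁻ x in C ∩ Ω, ‖(G - classicalGrad φ) x‖ₑ := by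
      rw [← lintegral_add_left' (hGm.mono_measure
        (Measure.restrict_mono Set.inter_subset_right le_rfl)).enorm]
      refine lintegral_mono fun x => ?_
      calc ‖classicalGrad φ x‖ₑ = ‖G x - (G x - classicalGrad φ x)‖ₑ := by congr 1; abel
        _ ≤ _ := enorm_sub_le
    calc ∫⁻ x in W, ‖u x‖ₑ
        ≤ ENNReal.ofReal l * ((∫⁻ x in C ∩ Ω, ‖G x‖ₑ) + ε * b) + ε * a :=
          e4.trans (add_le_add (e3.trans (mul_le_mul_right (e5.trans (by gcongr)) _)) e1)
      _ = _ := by rw [hK]; ring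
  -- The approximation error is `ε * K` with `K` finite, so `ε` can be tuned to fill exactly the gap
  -- up to any larger `c`; `K = 0` is separate because of the division.
  refine le_of_forall_gt_imp_ge_of_dense fun c hc => ?_
  rcases eq_or_ne K 0 with h0 | h0
  · have := key 1 one_pos
    rw [h0, mul_zero, add_zero] at this
    exact this.trans hc.le
  · have hlt : ENNReal.ofReal l * ∫⁻ x in C ∩ Ω, ‖G x‖ₑ ≠ ⊤ := hc.ne_top
    refine (key ((c - ENNReal.ofReal l * (∫⁻ x in C ∩ Ω, ‖G x‖ₑ)) / K)
      (ENNReal.div_pos (tsub_pos_of_lt hc).ne' hKf)).trans ?_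
    rw [ENNReal.div_mul_cancel h0 hKf, add_tsub_cancel_of_le hc.le]

/-! ### Rigid fields and their gradients. -/

lemma sum_sq_inner_axes_le (L : E3 ≃ₗᵢ[ℝ] E3) (w : E3) :
    inner ℝ w (L (EuclideanSpace.single 0 1)) ^ 2 +
      inner ℝ w (L (EuclideanSpace.single 1 1)) ^ 2 ≤ ‖w‖ ^ 2 := by
  have h : ∀ i, inner ℝ w (L (EuclideanSpace.single i 1)) = (L.symm w) i := fun i => by
    rw [← LinearIsometryEquiv.inner_map_map L.symm]
    simp [EuclideanSpace.inner_single_right]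
  rw [h, h, ← LinearIsometryEquiv.norm_map L.symm w, EuclideanSpace.norm_sq_eq]
  simp only [Fin.sum_univ_three, Real.norm_eq_abs, sq_abs]
  nlinarith [sq_nonneg ((L.symm w) 2)]

lemma norm_sq_toLp_crossProduct (ω : Fin 3 → ℝ) (v : E3) :
    ‖(WithLp.toLp 2 (crossProduct ω v.ofLp) : E3)‖ ^ 2 =
      ‖(WithLp.toLp 2 ω : E3)‖ ^ 2 * ‖v‖ ^ 2 - inner ℝ (WithLp.toLp 2 ω : E3) v ^ 2 := by
  simp only [EuclideanSpace.norm_sq_eq, cross_apply, Fin.sum_univ_three, Real.norm_eq_abs, sq_abs,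
    EuclideanSpace.inner_eq_star_dotProduct, dotProduct, star_trivial, Pi.star_apply]
  simp
  ring

/-- For orthonormal `e₀, e₁`, Lagrange's identity gives `|ω × e₀|² + |ω × e₁|² = 2|ω|² - (ω·e₀)² -
(ω·e₁)² ≥ |ω|²`. Thus two horizontal differences already control all of `ω`. -/
lemma norm_le_add_norm_crossProduct (L : E3 ≃ₗᵢ[ℝ] E3) (ω : Fin 3 → ℝ) :
    ‖(WithLp.toLp 2 ω : E3)‖ ≤
      ‖(WithLp.toLp 2 (crossProduct ω (L (EuclideanSpace.single 0 1)).ofLp) : E3)‖ +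
      ‖(WithLp.toLp 2 (crossProduct ω (L (EuclideanSpace.single 1 1)).ofLp) : E3)‖ := by
  have h := sum_sq_inner_axes_le L (WithLp.toLp 2 ω)
  have h0 := norm_sq_toLp_crossProduct ω (L (EuclideanSpace.single 0 1))
  have h1 := norm_sq_toLp_crossProduct ω (L (EuclideanSpace.single 1 1))
  simp only [LinearIsometryEquiv.norm_map, PiLp.norm_single, norm_one] at h0 h1
  refine abs_le_of_sq_le_sq' ?_ (by positivity) |>.2
  nlinarith [mul_nonneg
    (norm_nonneg (WithLp.toLp 2 (crossProduct ω (L (EuclideanSpace.single 0 1)).ofLp) : E3))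
    (norm_nonneg (WithLp.toLp 2 (crossProduct ω (L (EuclideanSpace.single 1 1)).ofLp) : E3))]

/-- The gradient of the rigid field `x ↦ a + ω × (x - xs)`. -/
def crossMatrix (ω : Fin 3 → ℝ) : M3 :=
  WithLp.toLp 2 fun ij => crossProduct ω (Pi.single ij.2 1) ij.1

lemma norm_crossMatrix_le (ω : Fin 3 → ℝ) :
    ‖crossMatrix ω‖ ≤ 2 * ‖(WithLp.toLp 2 ω : E3)‖ := by
  refine abs_le_of_sq_le_sq' ?_ (by positivity) |>.2
  rw [mul_pow, EuclideanSpace.norm_sq_eq, EuclideanSpace.norm_sq_eq, Fintype.sum_prod_type]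
  simp [crossMatrix, cross_apply, Fin.sum_univ_three]
  nlinarith [sq_nonneg (ω 0), sq_nonneg (ω 1), sq_nonneg (ω 2)]

/-- The rigid velocity field `x ↦ a + ω × (x - xs)`. -/
def rigidField (a ω : Fin 3 → ℝ) (xs x : E3) : E3 :=
  WithLp.toLp 2 (a + crossProduct ω (WithLp.ofLp (x - xs)))

lemma rigidField_apply (a ω : Fin 3 → ℝ) (xs x : E3) (i : Fin 3) :
    rigidField a ω xs x i = a i + ∑ j, crossMatrix ω (i, j) * (x j - xs j) := by
  fin_cases i <;>
    simp [rigidField, crossMatrix, cross_apply, Fin.sum_univ_three, Matrix.vecHead, Matrix.vecTail] <;>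
    ring

lemma rigidField_add_sub (a ω : Fin 3 → ℝ) (xs x v : E3) :
    rigidField a ω xs (x + v) - rigidField a ω xs x =
      WithLp.toLp 2 (crossProduct ω v.ofLp) := by
  ext i
  fin_cases i <;> simp [rigidField, cross_apply] <;> ring

lemma continuous_rigidField (a ω : Fin 3 → ℝ) (xs : E3) : Continuous (rigidField a ω xs) := by
  refine (PiLp.continuous_toLp 2 _).comp (continuous_pi fun i => ?_)
  have h : ∀ x, (a + crossProduct ω (WithLp.ofLp (x - xs))) i = rigidField a ω xs x i :=
    fun x => rfl
  simp_rw [h, rigidField_apply]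
  fun_prop

lemma hasFDerivAt_rigidField_apply (a ω : Fin 3 → ℝ) (xs x : E3) (i : Fin 3) :
    HasFDerivAt (fun y => rigidField a ω xs y i)
      (∑ j, crossMatrix ω (i, j) • (EuclideanSpace.proj j : E3 →L[ℝ] ℝ)) x := by
  simp_rw [rigidField_apply]
  refine HasFDerivAt.const_add _ (HasFDerivAt.fun_sum fun j _ => ?_)
  exact ((EuclideanSpace.proj j : E3 →L[ℝ] ℝ).hasFDerivAt.sub_const _).const_mul _

/-- A weak gradient of a field which is rigid in an open set is constant there. -/
lemma IsWeakGrad.ae_eq_crossMatrix {S Ω : Set E3} (hS : IsOpen S) (hSΩ : S ⊆ Ω)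
    {u : E3 → E3} {G : E3 → M3} (hG : IsWeakGrad Ω u G)
    (hGint : LocallyIntegrableOn G S) {a ω : Fin 3 → ℝ} {xs : E3}
    (hr : ∀ᵐ x ∂(volume.restrict S), u x = rigidField a ω xs x) :
    ∀ᵐ x ∂(volume.restrict S), G x = crossMatrix ω := by
  have key : ∀ ij : Fin 3 × Fin 3, ∀ᵐ x ∂volume, x ∈ S → G x ij - crossMatrix ω ij = 0 := by
    rintro ⟨i, j⟩
    have hGij : LocallyIntegrableOn (fun x => G x (i, j)) S := fun x hx => by
      obtain ⟨U, hU, hUi⟩ := hGint x hx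
      exact ⟨U, hU, (EuclideanSpace.proj (i, j) : M3 →L[ℝ] ℝ).integrable_comp hUi⟩
    have hcst : LocallyIntegrableOn (fun _ : E3 => crossMatrix ω (i, j)) S :=
      (locallyIntegrable_const _).locallyIntegrableOn S
    refine hS.ae_eq_zero_of_integral_contDiff_smul_eq_zero (hGij.sub hcst)
      fun g hg hgc hgS => ?_
    have hgd : Differentiable ℝ g := hg.differentiable (by simp)
    have hgf : Continuous fun x => fderiv ℝ g x (EuclideanSpace.single j 1) :=
      (hg.continuous_fderiv (by simp)).clm_apply continuous_const
    have hgfc : HasCompactSupport fun x => fderiv ℝ g x (EuclideanSpace.single j 1) :=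
      hgc.fderiv_apply ℝ _
    have h1 := hG g ⟨hg, hgc, hgS.trans hSΩ⟩ i j
    have hz : ∀ x, x ∉ S → g x = 0 := fun x hx =>
      image_eq_zero_of_notMem_tsupport fun h => hx (hgS h)
    have hz' : ∀ x, x ∉ S → fderiv ℝ g x (EuclideanSpace.single j 1) = 0 := fun x hx => by
      have : fderiv ℝ g x = 0 := by
        by_contra h
        exact hx (hgS (support_fderiv_subset ℝ h))
      simp [this]
    rw [setIntegral_eq_integral_of_forall_compl_eq_zero (fun x hx => by
        rw [hz' x fun h => hx (hSΩ h), mul_zero]),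
      setIntegral_eq_integral_of_forall_compl_eq_zero (fun x hx => by
        rw [hz x fun h => hx (hSΩ h), mul_zero])] at h1
    have h2 : ∫ x, u x i * fderiv ℝ g x (EuclideanSpace.single j 1) =
        ∫ x, rigidField a ω xs x i * fderiv ℝ g x (EuclideanSpace.single j 1) := by
      refine integral_congr_ae ?_
      filter_upwards [(ae_restrict_iff' hS.measurableSet).1 hr] with x hx
      by_cases hxS : x ∈ S
      · rw [hx hxS]
      · rw [hz' x hxS, mul_zero, mul_zero]
    have hrc : Continuous fun x => rigidField a ω xs x i :=
      (EuclideanSpace.proj i : E3 →L[ℝ] ℝ).continuous.comp (continuous_rigidField a ω xs)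
    have hfd : ∀ x, fderiv ℝ (fun x => rigidField a ω xs x i) x (EuclideanSpace.single j 1) =
        crossMatrix ω (i, j) := fun x => by
      rw [(hasFDerivAt_rigidField_apply a ω xs x i).fderiv]
      fin_cases j <;> simp [Fin.sum_univ_three]
    have hci : Integrable fun x => crossMatrix ω (i, j) * g x :=
      (hg.continuous.integrable_of_hasCompactSupport hgc).const_mul _
    -- Test functions supported in `S` see only the rigid field, which is smooth, so classical
    -- integration by parts identifies the weak gradient.
    have h3 := integral_mul_fderiv_eq_neg_fderiv_mul_of_integrable (μ := volume)
      (f := fun x => rigidField a ω xs x i) (g := g) (v := EuclideanSpace.single j 1)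
      (by simpa only [hfd] using hci)
      ((hrc.mul hgf).integrable_of_hasCompactSupport hgfc.mul_left)
      ((hrc.mul hg.continuous).integrable_of_hasCompactSupport hgc.mul_left)
      (fun x _ => (hasFDerivAt_rigidField_apply a ω xs x i).differentiableAt) (fun x _ => hgd x)
    simp only [hfd] at h3
    have hGi : Integrable fun x => G x (i, j) * g x := by
      have := (hGij.integrableOn_compact_subset hgS hgc).continuousOn_mul
        (hg.continuous.continuousOn) hgc
      refine (integrableOn_iff_integrable_of_support_subset ?_).1
        (this.congr_fun (fun x _ => mul_comm _ _) hgc.measurableSet)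
      intro x hx
      exact subset_tsupport _ fun h => hx (by simp [h])
    simp only [smul_eq_mul, mul_sub]
    rw [integral_sub (by simpa only [mul_comm] using hGi) (by simpa only [mul_comm] using hci)]
    simp only [mul_comm (g _)]
    linarith
  rw [ae_restrict_iff' hS.measurableSet]
  filter_upwards [ae_all_iff.2 key] with x hx hxS
  ext ij
  exact sub_eq_zero.1 (hx ij hxS)

/-! ### Jensen's inequality from the tangent line. -/

/-- Convexity of `x ^ p`: its graph lies above the tangent at `N`. This is Bernoulli's inequality
after scaling by `N`. -/
lemma rpow_tangent_le {N x p : ℝ} (hN : 0 < N) (hx : 0 ≤ x) (hp : 1 ≤ p) :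
    N ^ p + p * N ^ (p - 1) * (x - N) ≤ x ^ p := by
  have h := one_add_mul_self_le_rpow_one_add (s := x / N - 1) (by
    have : 0 ≤ x / N := by positivity
    linarith) hp
  rw [add_sub_cancel, Real.div_rpow hx hN.le, le_div_iff₀ (by positivity)] at h
  refine le_trans (le_of_eq ?_) h
  rw [Real.rpow_sub_one hN.ne']
  field_simp

/-- A Jensen type inequality: if `f` has integral at least `N * V` over a space of measure at most
`V`, then `f ^ p` has integral at least `N ^ p * V`. -/
lemma rpow_mul_le_integral_rpow {X : Type*} [MeasurableSpace X] {μ : Measure X} [IsFiniteMeasure μ]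
    {f : X → ℝ} {N V p : ℝ} (hp : 1 ≤ p) (hf : ∀ x, 0 ≤ f x) (hfi : Integrable f μ)
    (hfp : Integrable (fun x => f x ^ p) μ) (hN : 0 ≤ N) (hV : μ.real Set.univ ≤ V)
    (hI : N * V ≤ ∫ x, f x ∂μ) : N ^ p * V ≤ ∫ x, f x ^ p ∂μ := by
  rcases hN.eq_or_lt with rfl | hN
  · rw [Real.zero_rpow (by linarith), zero_mul]
    exact integral_nonneg fun x => Real.rpow_nonneg (hf x) p
  have h := integral_mono (μ := μ) (f := fun x => N ^ p + p * N ^ (p - 1) * (f x - N))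
    (by fun_prop) hfp fun x => rpow_tangent_le hN (hf x) hp
  refine le_trans ?_ h
  rw [integral_add (by fun_prop) (by fun_prop), integral_const_mul,
    integral_sub hfi (by fun_prop), integral_const, integral_const, smul_eq_mul, smul_eq_mul]
  have e : N ^ p = N ^ (p - 1) * N := by
    rw [Real.rpow_sub_one hN.ne', div_mul_cancel₀ _ hN.ne']
  rw [e]
  have hc : 0 ≤ N ^ (p - 1) := by positivity
  -- With `m` the total mass and `I` the integral of `f`, the integrated tangent line exceeds `N ^ p
  -- * V` by `N^{p-1} (p (I - NV) + (p-1) N (V - m))`; both terms are nonnegative.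
  have h1 : 0 ≤ N ^ (p - 1) * (p * (∫ x, f x ∂μ - N * V)) :=
    mul_nonneg hc (mul_nonneg (by linarith) (by linarith))
  have h2 : 0 ≤ N ^ (p - 1) * ((p - 1) * (N * (V - μ.real Set.univ))) :=
    mul_nonneg hc (mul_nonneg (by linarith) (mul_nonneg hN.le (by linarith)))
  nlinarith

/-! ### Volumes of boxes and of the gap cylinder. -/

lemma IsometryEquiv.measurePreserving_E3 (R : E3 ≃ᵢ E3) : MeasurePreserving R := by
  obtain ⟨L, hL⟩ := R.exists_linearIsometryEquiv
  have h : (R : E3 → E3) = (fun x => x + R 0) ∘ L := funext hL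
  rw [h]
  exact (measurePreserving_add_right _ _).comp L.measurePreserving

lemma IsometryEquiv.volume_image_E3 (R : E3 ≃ᵢ E3) (s : Set E3) :
    volume (R '' s) = volume s := by
  rw [← R.measurePreserving_E3.measure_preimage_emb R.toHomeomorph.measurableEmbedding,
    Set.preimage_image_eq _ R.injective]

/-- The open box with opposite corners `a` and `b`. -/
def openBox (a b : Fin 3 → ℝ) : Set E3 := {x | ∀ i, x i ∈ Set.Ioo (a i) (b i)}

lemma openBox_eq_preimage (a b : Fin 3 → ℝ) :
    openBox a b = (MeasurableEquiv.toLp 2 (Fin 3 → ℝ)).symm ⁻¹'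
      Set.univ.pi fun i => Set.Ioo (a i) (b i) := by
  ext x
  simp [openBox]

lemma measurableSet_openBox (a b : Fin 3 → ℝ) : MeasurableSet (openBox a b) := by
  rw [openBox_eq_preimage]
  exact (MeasurableEquiv.measurable _) (MeasurableSet.univ_pi fun i => measurableSet_Ioo)

lemma volume_openBox (a b : Fin 3 → ℝ) :
    volume (openBox a b) = ∏ i, ENNReal.ofReal (b i - a i) := by
  rw [openBox_eq_preimage,
    (EuclideanSpace.volume_preserving_symm_measurableEquiv_toLp (Fin 3)).measure_preimage_equiv,
    Real.volume_pi_Ioo]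

lemma IsometryEquiv.measurableSet_image (R : E3 ≃ᵢ E3) {s : Set E3} (hs : MeasurableSet s) :
    MeasurableSet (R '' s) :=
  R.toHomeomorph.measurableEmbedding.measurableSet_image.2 hs

lemma measurable_planarNorm : Measurable planarNorm := by
  unfold planarNorm
  fun_prop

lemma measurableSet_gapCylinder (R : E3 ≃ᵢ E3) (α k h σ : ℝ) :
    MeasurableSet (gapCylinder R α k h σ) := by
  refine R.measurableSet_image ?_
  have h2 : Measurable fun x : E3 => x 2 := by fun_prop
  exact (measurableSet_lt measurable_const measurable_planarNorm).inter
    ((measurableSet_lt measurable_planarNorm measurable_const).inter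
      ((measurableSet_lt measurable_const h2).inter (measurableSet_lt h2 measurable_const)))

lemma volume_gapCylinder_le (R : E3 ≃ᵢ E3) {α k h σ : ℝ} (hσ : 0 ≤ σ) :
    volume (gapCylinder R α k h σ) ≤
      ENNReal.ofReal (4 * σ ^ 2 * (h + 3 * (k * σ ^ (1 + α)))) := by
  rw [gapCylinder, R.volume_image_E3]
  have hsub : {x : E3 | 0 < planarNorm x ∧ planarNorm x < σ ∧
      -(k * σ ^ (1 + α)) < x 2 ∧ x 2 < h + 2 * (k * σ ^ (1 + α))} ⊆
      openBox ![-σ, -σ, -(k * σ ^ (1 + α))] ![σ, σ, h + 2 * (k * σ ^ (1 + α))] := by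
    rintro x ⟨-, hx, hx2, hx3⟩
    rw [planarNorm, Real.sqrt_lt' (by linarith [Real.sqrt_nonneg (x 0 ^ 2 + x 1 ^ 2),
      show √(x 0 ^ 2 + x 1 ^ 2) < σ from hx])] at hx
    have h0 := abs_lt_of_sq_lt_sq (show x 0 ^ 2 < σ ^ 2 by nlinarith [sq_nonneg (x 1)]) hσ
    have h1 := abs_lt_of_sq_lt_sq (show x 1 ^ 2 < σ ^ 2 by nlinarith [sq_nonneg (x 0)]) hσ
    rw [abs_lt] at h0 h1
    intro i
    fin_cases i
    · exact h0
    · exact h1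
    · exact ⟨hx2, hx3⟩
  refine (measure_mono hsub).trans (le_of_eq ?_)
  rw [volume_openBox]
  simp only [Fin.prod_univ_three, Matrix.cons_val]
  rw [← ENNReal.ofReal_mul (by linarith), ← ENNReal.ofReal_mul (by nlinarith)]
  congr 1
  ring

/-! ### Angular velocity from the mean of a rigid field. -/

/-- The increment of a rigid field along `v` is the constant `ω × v`; integrating it over `A` costs
one integral over `A` and one over its translate, both inside `B`. -/
lemma enorm_crossProduct_mul_volume_le {A B : Set E3} (hA : MeasurableSet A) {v : E3}
    (hAB : A ⊆ B) (hAvB : ∀ x ∈ A, x + v ∈ B) (a ω : Fin 3 → ℝ) (xs : E3)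
    (hB : MeasurableSet B) :
    ‖(WithLp.toLp 2 (crossProduct ω v.ofLp) : E3)‖ₑ * volume A ≤
      2 * ∫⁻ x in B, ‖rigidField a ω xs x‖ₑ := by
  have hc := continuous_rigidField a ω xs
  have h1 : ∫⁻ x in A, ‖rigidField a ω xs (x + v)‖ₑ ≤ ∫⁻ x in B, ‖rigidField a ω xs x‖ₑ := by
    rw [← lintegral_indicator hA, ← lintegral_indicator hB,
      ← lintegral_add_right_eq_self (B.indicator _) v]
    refine lintegral_mono fun x => Set.indicator_apply_le (g := fun x =>
      B.indicator (fun x => ‖rigidField a ω xs x‖ₑ) (x + v)) fun hx => ?_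
    rw [Set.indicator_of_mem (hAvB x hx)]
  calc ‖(WithLp.toLp 2 (crossProduct ω v.ofLp) : E3)‖ₑ * volume A
      = ∫⁻ x in A, ‖rigidField a ω xs (x + v) - rigidField a ω xs x‖ₑ := by
        simp_rw [rigidField_add_sub]
        rw [setLIntegral_const]
    _ ≤ ∫⁻ x in A, (‖rigidField a ω xs (x + v)‖ₑ + ‖rigidField a ω xs x‖ₑ) :=
        lintegral_mono fun x => enorm_sub_le
    _ = (∫⁻ x in A, ‖rigidField a ω xs (x + v)‖ₑ) + ∫⁻ x in A, ‖rigidField a ω xs x‖ₑ :=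
        lintegral_add_right _ (by fun_prop)
    _ ≤ (∫⁻ x in B, ‖rigidField a ω xs x‖ₑ) + ∫⁻ x in B, ‖rigidField a ω xs x‖ₑ :=
        add_le_add h1 (lintegral_mono_set hAB)
    _ = _ := (two_mul _).symm

/-- The angular velocity of a rigid field is controlled by its mean over a slab. -/
lemma enorm_angular_mul_le (R : E3 ≃ᵢ E3) {σ b τ : ℝ} (hσ : 0 < σ) (hτ : 0 < τ)
    (a ω : Fin 3 → ℝ) (xs : E3) :
    ENNReal.ofReal (‖(WithLp.toLp 2 ω : E3)‖ * (σ ^ 3 * τ / 64)) ≤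
      4 * ∫⁻ x in R '' openBox ![0, 0, b] ![σ / 2, σ / 2, b + τ], ‖rigidField a ω xs x‖ₑ := by
  obtain ⟨L, hL⟩ := R.exists_linearIsometryEquiv
  set B := openBox ![0, 0, b] ![σ / 2, σ / 2, b + τ] with hB
  -- Shifting this smaller box by `σ/4` along either horizontal axis keeps it in `B`. Its volume
  -- `σ²τ/16` times the shift gives the factor `σ³τ/64`.
  set A := openBox ![0, 0, b] ![σ / 4, σ / 4, b + τ] with hA
  have hvol : volume (R '' A) = ENNReal.ofReal (σ ^ 2 * τ / 16) := by
    rw [R.volume_image_E3, hA, volume_openBox]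
    simp only [Fin.prod_univ_three, Matrix.cons_val]
    rw [← ENNReal.ofReal_mul (by linarith), ← ENNReal.ofReal_mul (by nlinarith)]
    congr 1
    ring
  have hAB : A ⊆ B := by
    intro x hx i
    have := hx i
    fin_cases i <;> simp at this ⊢ <;> constructor <;> linarith
  have step : ∀ j : Fin 3, j ≠ 2 →
      ENNReal.ofReal (‖(WithLp.toLp 2 (crossProduct ω (L (EuclideanSpace.single j 1)).ofLp) : E3)‖ *
        (σ ^ 3 * τ / 64)) ≤ 2 * ∫⁻ x in R '' B, ‖rigidField a ω xs x‖ₑ := by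
    intro j hj
    refine le_trans (le_of_eq ?_) (enorm_crossProduct_mul_volume_le (A := R '' A)
      (v := (σ / 4) • L (EuclideanSpace.single j 1)) (R.measurableSet_image
      (measurableSet_openBox _ _)) (Set.image_mono hAB) ?_ a ω xs
      (R.measurableSet_image (measurableSet_openBox _ _)))
    · rw [hvol, ← ofReal_norm, ← ENNReal.ofReal_mul (norm_nonneg _), WithLp.ofLp_smul,
        LinearMap.map_smul, WithLp.toLp_smul, norm_smul, Real.norm_of_nonneg (by linarith)]
      congr 1
      ring
    · rintro _ ⟨x, hx, rfl⟩
      refine ⟨x + (σ / 4) • EuclideanSpace.single j 1, fun i => ?_, ?_⟩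
      · have := hx i
        fin_cases j <;> fin_cases i <;> simp at hj this ⊢ <;> constructor <;> linarith
      · rw [hL, hL x, map_add, map_smul]
        abel
  have h := norm_le_add_norm_crossProduct L ω
  calc _ ≤ _ := ENNReal.ofReal_le_ofReal (mul_le_mul_of_nonneg_right h (by positivity))
    _ = _ := by rw [add_mul, ENNReal.ofReal_add (by positivity) (by positivity)]
    _ ≤ _ := add_le_add (step 0 (by decide)) (step 1 (by decide))
    _ = _ := by rw [← add_mul]; norm_num

lemma setDist_nonneg (A B : Set E3) : 0 ≤ setDist A B :=
  Real.sInf_nonneg fun _ ⟨_, _, _, _, hd⟩ => hd ▸ dist_nonneg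

/-! ### Geometry of the gap. -/

section GapFrame

variable {α k σ₀ : ℝ} {Ω S : Set E3} {P Q : E3} {R : E3 ≃ᵢ E3}

lemma IsGapFrame.notMem_outer (hα : 0 < α) (hk : 0 < k) (hσ₀ : 0 < σ₀)
    (hR : IsGapFrame Ω S P Q R) (hΩ : IsUniformlyC1 α k σ₀ Ω) {x : E3}
    (h1 : planarNorm x < σ₀) (h2 : k * planarNorm x ^ (1 + α) < -x 2)
    (h3 : -x 2 < k * σ₀ ^ (1 + α)) : R x ∉ Ω := by
  obtain ⟨L, hL⟩ := R.exists_linearIsometryEquiv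
  have hx : x 2 < 0 := by
    have : 0 ≤ k * planarNorm x ^ (1 + α) :=
      mul_nonneg hk.le (Real.rpow_nonneg (planarNorm_nonneg x) _)
    linarith
  have hν := hR.normal_Q
  rw [hL, add_sub_cancel_right] at hν
  rw [← abs_of_neg hx] at h2 h3
  have h := (hΩ.mem_iff_of_innerNormal hα hk hσ₀ hR.mem_Q L hν x h1 h2 h3).2 hx
  rwa [hL, hR.origin]

lemma IsGapFrame.mem_inner (hα : 0 < α) (hk : 0 < k) (hσ₀ : 0 < σ₀)
    (hR : IsGapFrame Ω S P Q R) (hS : IsUniformlyC1 α k σ₀ S) {x : E3}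
    (h1 : planarNorm x < σ₀)
    (h2 : k * planarNorm x ^ (1 + α) < x 2 - setDist S (frontier Ω))
    (h3 : x 2 - setDist S (frontier Ω) < k * σ₀ ^ (1 + α)) : R x ∈ S := by
  obtain ⟨L, hL⟩ := R.exists_linearIsometryEquiv
  set h := setDist S (frontier Ω) with hh
  set y := x - axisPoint h with hy
  have hy2 : y 2 = x 2 - h := by simp [hy, axisPoint]
  have hyp : planarNorm y = planarNorm x := by simp [planarNorm, hy, axisPoint]
  have hpos : 0 < y 2 := by
    have : 0 ≤ k * planarNorm x ^ (1 + α) :=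
      mul_nonneg hk.le (Real.rpow_nonneg (planarNorm_nonneg x) _)
    linarith
  have hν := hR.normal_P
  rw [hL, add_sub_cancel_right] at hν
  rw [← hy2, ← hyp] at h2
  rw [← hy2] at h3
  rw [← abs_of_pos hpos] at h2 h3
  have := (hS.mem_iff_of_innerNormal hα hk hσ₀ hR.mem_P L hν y (hyp ▸ h1) h2 h3).1 hpos
  rwa [← hR.top, hL (axisPoint h), ← add_assoc, ← map_add, hy, sub_add_cancel, ← hL] at this

/-- The angular velocity of the solid is controlled by the gradient in the gap cylinder. -/
lemma IsGapFrame.angular_le (hα : 0 < α) (hk : 0 < k) (hσ₀ : 0 < σ₀)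
    (hR : IsGapFrame Ω S P Q R) (hΩo : IsOpen Ω) (hSΩ : S ⊆ Ω)
    (hΩ : IsUniformlyC1 α k σ₀ Ω) (hS : IsUniformlyC1 α k σ₀ S)
    {p : ℝ} (hp : 1 ≤ p) {u : E3 → E3} {G : E3 → M3} (hu : MemW10 p Ω u G)
    {a ω : Fin 3 → ℝ} {xs : E3} (hr : ∀ᵐ x ∂(volume.restrict S), u x = rigidField a ω xs x)
    {h σ : ℝ} (hh : h = setDist S (frontier Ω)) (hσ : 0 < σ) (hσ2 : σ ≤ σ₀ / 2) :
    ENNReal.ofReal (‖(WithLp.toLp 2 ω : E3)‖ * (σ ^ 3 * (k * σ ^ (1 + α)) / 64)) ≤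
      4 * (ENNReal.ofReal (h + 3 * (k * σ ^ (1 + α))) *
        ∫⁻ x in gapCylinder R α k h σ ∩ Ω, ‖G x‖ₑ) := by
  obtain ⟨L, hL⟩ := R.exists_linearIsometryEquiv
  have hh0 : 0 ≤ h := hh ▸ setDist_nonneg _ _
  have hlt : ∀ {r : ℝ}, 0 ≤ r → r < σ → k * r ^ (1 + α) < k * σ ^ (1 + α) := fun hr hrσ =>
    mul_lt_mul_of_pos_left (Real.rpow_lt_rpow hr hrσ (by linarith)) hk
  -- The box reaches `2τ` above `P` and its translate `2τ` below `Q`; `σ ≤ σ₀/2` keeps both within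
  -- the range of the local descriptions.
  have hτ2 : 2 * (k * σ ^ (1 + α)) ≤ k * σ₀ ^ (1 + α) := by
    have h1 : (2 : ℝ) ≤ 2 ^ (1 + α) := by
      conv_lhs => rw [← Real.rpow_one 2]
      exact Real.rpow_le_rpow_of_exponent_le (by norm_num) (by linarith)
    have h2 : (2 * σ) ^ (1 + α) ≤ σ₀ ^ (1 + α) :=
      Real.rpow_le_rpow (by linarith) (by linarith) (by linarith)
    rw [Real.mul_rpow (by norm_num) hσ.le] at h2
    have h3 : 2 * σ ^ (1 + α) ≤ σ₀ ^ (1 + α) :=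
      (mul_le_mul_of_nonneg_right h1 (by positivity)).trans h2
    nlinarith
  have hτ : 0 < k * σ ^ (1 + α) := by positivity
  set C := gapCylinder R α k h σ with hC
  set τ := k * σ ^ (1 + α) with hτdef
  -- The box lies off the axis with `|x'| < σ`, hence `k|x'|^{1+α} < τ`: it is above the boundary of
  -- `S` and inside the cylinder.
  set B := openBox ![0, 0, h + τ] ![σ / 2, σ / 2, h + τ + τ] with hB
  have hBp : ∀ x ∈ B, 0 < planarNorm x ∧ planarNorm x < σ ∧ h + τ < x 2 ∧ x 2 < h + 2 * τ := by
    intro x hx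
    have h0 := hx 0
    have h1 := hx 1
    have h2 := hx 2
    simp at h0 h1 h2
    refine ⟨Real.sqrt_pos.2 (by nlinarith), (Real.sqrt_lt' hσ).2 (by nlinarith), h2.1,
      by linarith⟩
  have hBS : R '' B ⊆ S := by
    rintro _ ⟨x, hx, rfl⟩
    obtain ⟨-, h1, h2, h3⟩ := hBp x hx
    have := hlt (planarNorm_nonneg x) h1
    exact hR.mem_inner hα hk hσ₀ hS (by linarith) (by rw [← hh]; linarith)
      (by rw [← hh]; linarith)
  have hshift : ∀ (x : E3) (s : ℝ), R x - s • L (axisPoint 1) = R (x - axisPoint s) := by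
    intro x s
    have : axisPoint s = s • axisPoint 1 := by
      ext i
      fin_cases i <;> simp [axisPoint]
    rw [hL, hL (x - axisPoint s), map_sub, this, map_smul]
    abel
  have hpl : ∀ (x : E3) (s : ℝ), planarNorm (x - axisPoint s) = planarNorm x := fun x s => by
    simp [planarNorm, axisPoint]
  have hx2 : ∀ (x : E3) (s : ℝ), (x - axisPoint s) 2 = x 2 - s := fun x s => by
    simp [axisPoint]
  have hBm : MeasurableSet (R '' B) := R.measurableSet_image (measurableSet_openBox _ _)
  have hP : ∫⁻ x in R '' B, ‖u x‖ₑ ≤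
      ENNReal.ofReal (h + 3 * τ) * ∫⁻ x in C ∩ Ω, ‖G x‖ₑ := by
    refine hu.lintegral_enorm_le hp hΩo.measurableSet (measurableSet_gapCylinder R α k h σ)
      hBm (hBS.trans hSΩ) ((volume_gapCylinder_le R hσ.le).trans_lt ENNReal.ofReal_lt_top).ne ?_
      (ν := L (axisPoint 1)) (by simp [norm_axisPoint]) (by linarith) ?_ ?_
    · rw [R.volume_image_E3, volume_openBox]
      exact (ENNReal.prod_lt_top fun i _ => ENNReal.ofReal_lt_top).ne
    · rintro _ ⟨x, hx, rfl⟩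
      obtain ⟨-, h1, h2, h3⟩ := hBp x hx
      have := hlt (planarNorm_nonneg x) h1
      rw [hshift]
      exact hR.notMem_outer hα hk hσ₀ hΩ (by rw [hpl]; linarith) (by rw [hpl, hx2]; linarith)
        (by rw [hx2]; linarith)
    · rintro _ ⟨x, hx, rfl⟩ s ⟨hs0, hsl⟩ hmem
      obtain ⟨h0, h1, h2, h3⟩ := hBp x hx
      have := hlt (planarNorm_nonneg x) h1
      rw [hshift] at hmem ⊢
      refine ⟨_, ⟨by rwa [hpl], by rwa [hpl], ?_, by rw [hx2]; linarith⟩, rfl⟩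
      -- A downward segment can leave the cylinder only through its bottom `x₃ = -τ`, and from there
      -- on it is already outside `Ω`.
      by_contra hcon
      rw [hx2] at hcon
      exact hR.notMem_outer hα hk hσ₀ hΩ (by rw [hpl]; linarith) (by rw [hpl, hx2]; linarith)
        (by rw [hx2]; linarith) hmem
  have hru : ∫⁻ x in R '' B, ‖rigidField a ω xs x‖ₑ = ∫⁻ x in R '' B, ‖u x‖ₑ := by
    refine lintegral_congr_ae ?_
    filter_upwards [ae_mono (Measure.restrict_mono hBS le_rfl) hr] with x hx
    rw [hx]
  refine (enorm_angular_mul_le R hσ hτ a ω xs (b := h + τ)).trans ?_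
  rw [← hB, hru]
  gcongr

end GapFrame

/-! ### Absorption of the solid part and conclusion. -/

/-- If `G` is constant a.e. on `E`, and its norm `N` there is controlled by the mean of `‖G‖` over
`F ∪ E`, then the `p`-th power integral over `F ∪ E` is controlled by the one over `F`. -/
lemma setIntegral_rpow_le_two_mul {G : E3 → M3} {A E F : Set E3} {p V c : ℝ} {g : M3}
    (hp : 1 ≤ p) (hA : A = F ∪ E) (hdisj : Disjoint F E)
    (hE : MeasurableSet E) (hG : MemLp G (ENNReal.ofReal p) (volume.restrict A))
    (hV0 : volume A ≤ ENNReal.ofReal V) (hV : 0 ≤ V)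
    (hgE : ∀ᵐ x ∂(volume.restrict E), G x = g)
    (hg : ‖g‖ ≤ c * ∫ x in A, ‖G x‖) (hcV : c * V ≤ 1 / 2) :
    ∫ x in A, ‖G x‖ ^ p ≤ 2 * ∫ x in F, ‖G x‖ ^ p := by
  have hAfin : volume A < ⊤ := hV0.trans_lt ENNReal.ofReal_lt_top
  have : IsFiniteMeasure (volume.restrict A) := ⟨by rwa [Measure.restrict_apply_univ]⟩
  have hFA : F ⊆ A := hA ▸ Set.subset_union_left
  have hEA : E ⊆ A := hA ▸ Set.subset_union_right
  have : IsFiniteMeasure (volume.restrict F) :=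
    ⟨by rw [Measure.restrict_apply_univ]; exact (measure_mono hFA).trans_lt hAfin⟩
  have hle : ∀ {s : Set E3}, s ⊆ A → volume.real s ≤ V := fun hs =>
    ENNReal.toReal_le_of_le_ofReal hV ((measure_mono hs).trans hV0)
  have hq : 1 ≤ ENNReal.ofReal p := by
    rw [← ENNReal.ofReal_one]; exact ENNReal.ofReal_le_ofReal hp
  have hi : IntegrableOn (fun x => ‖G x‖) A := (hG.integrable hq).norm
  have hip : IntegrableOn (fun x => ‖G x‖ ^ p) A := by
    have := hG.integrable_norm_rpow (by simp; linarith) (by simp)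
    rwa [ENNReal.toReal_ofReal (by linarith)] at this
  have e1 : ∫ x in A, ‖G x‖ = (∫ x in F, ‖G x‖) + ‖g‖ * volume.real E := by
    rw [hA, setIntegral_union hdisj hE (hi.mono_set hFA) (hi.mono_set hEA),
      integral_congr_ae (g := fun _ => ‖g‖) (hgE.mono fun x hx => by simp only [hx]),
      setIntegral_const, smul_eq_mul, mul_comm ‖g‖]
  have e2 : ∫ x in A, ‖G x‖ ^ p = (∫ x in F, ‖G x‖ ^ p) + ‖g‖ ^ p * volume.real E := by
    rw [hA, setIntegral_union hdisj hE (hip.mono_set hFA) (hip.mono_set hEA),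
      integral_congr_ae (g := fun _ => ‖g‖ ^ p) (hgE.mono fun x hx => by simp only [hx]),
      setIntegral_const, smul_eq_mul, mul_comm (‖g‖ ^ p)]
  -- From `‖g‖V ≤ ½ ∫_A ‖G‖ ≤ ½ ∫_F ‖G‖ + ½ ‖g‖V`, the last term is absorbed on the left.
  have hI : ‖g‖ * V ≤ ∫ x in F, ‖G x‖ := by
    have h1 : ‖g‖ * volume.real E ≤ ‖g‖ * V :=
      mul_le_mul_of_nonneg_left (hle hEA) (norm_nonneg _)
    have h2 : ‖g‖ * V ≤ c * V * ∫ x in A, ‖G x‖ := by nlinarith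
    have h3 : 0 ≤ ∫ x in A, ‖G x‖ := integral_nonneg fun _ => norm_nonneg _
    have h4 : c * V * ∫ x in A, ‖G x‖ ≤ 1 / 2 * ∫ x in A, ‖G x‖ :=
      mul_le_mul_of_nonneg_right hcV h3
    linarith
  have key := rpow_mul_le_integral_rpow hp (fun x => norm_nonneg (G x)) (hi.mono_set hFA)
    (hip.mono_set hFA) (norm_nonneg g)
    (by rw [measureReal_restrict_apply_univ]; exact hle hFA) hI
  have h5 : ‖g‖ ^ p * volume.real E ≤ ‖g‖ ^ p * V :=
    mul_le_mul_of_nonneg_left (hle hEA) (by positivity)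
  rw [e2]
  linarith

theorem lemma2p2 (α k σ₀ H p : ℝ) (hα : 0 < α) (hα' : α ≤ 1) (hk : 0 < k) (hσ₀ : 0 < σ₀)
    (hH : 0 < H) (hp : 1 ≤ p) :
    ∃ Hs σs : ℝ, 0 < Hs ∧ Hs ≤ H ∧ 0 < σs ∧ σs ≤ σ₀ / 2 ∧
      ∀ (Ω S : Set E3), IsOpenDomain Ω → IsOpenDomain S → Bornology.IsBounded S → S ⊆ Ω →
        Metric.diam S = H → IsUniformlyC1 α k σ₀ Ω → IsUniformlyC1 α k σ₀ S →
      ∀ (P Q : E3) (R : E3 ≃ᵢ E3), IsGapFrame Ω S P Q R →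
      ∀ (u : E3 → E3) (G : E3 → M3), MemRigidW10 p S Ω u G → IsDivFree Ω G →
      ∀ h σ : ℝ, h = setDist S (frontier Ω) → h ≤ Hs →
        σ₀ / 2 * (h / H) ^ (1 / (1 + α)) ≤ σ → σ ≤ σs →
        ∫ x in gapCylinder R α k h σ ∩ Ω, ‖G x‖ ^ p ≤
          2 * ∫ x in gapCylinder R α k h σ ∩ (Ω \ closure S), ‖G x‖ ^ p := by
  -- `M` is the constant for which the lower bound on `σ` reads `h ≤ Mτ`. Below, `κ` solves `2048 (M
  -- + 3)² k κ = 1/2`.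
  set M := H * (2 / σ₀) ^ (1 + α) / k with hM
  have hM0 : 0 < M := by positivity
  set κ := (1 / (4096 * (M + 3) ^ 2 * k)) with hκ
  have hκ0 : 0 < κ := by positivity
  -- No smaller threshold than `H` is needed for `h`: its lower bound on `σ` together with `σ ≤ σ_*`
  -- already forces `h` to be small.
  refine ⟨H, min (σ₀ / 2) (κ ^ (1 / α)), hH, le_rfl, by positivity, min_le_left _ _, ?_⟩
  intro Ω S hΩd hSd _ hSΩ _ hΩ hS P Q R hR u G hu _ h σ hh _ hσl hσu
  have hh0 : 0 ≤ h := hh ▸ setDist_nonneg _ _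
  have hσ0 : 0 ≤ σ := le_trans (by positivity) hσl
  -- When `h = 0` the value `σ = 0` is admissible, and the cylinder is then empty.
  rcases hσ0.eq_or_lt with rfl | hσ
  · have : gapCylinder R α k h 0 = ∅ := by
      rw [gapCylinder, Set.image_eq_empty]
      exact Set.eq_empty_of_forall_notMem fun x hx => absurd (hx.1.trans hx.2.1) (lt_irrefl _)
    simp [this]
  have hσ2 : σ ≤ σ₀ / 2 := hσu.trans (min_le_left _ _)
  have hσκ : σ ^ α ≤ κ := by
    have := Real.rpow_le_rpow hσ.le (hσu.trans (min_le_right _ _)) hα.le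
    rwa [← Real.rpow_mul hκ0.le, one_div_mul_cancel hα.ne', Real.rpow_one] at this
  set τ := k * σ ^ (1 + α) with hτ
  have hτ0 : 0 < τ := by positivity
  have hhτ : h ≤ M * τ := by
    have h1 : (h / H) ^ (1 / (1 + α)) ≤ 2 / σ₀ * σ := by
      have : (h / H) ^ (1 / (1 + α)) = 2 / σ₀ * (σ₀ / 2 * (h / H) ^ (1 / (1 + α))) := by
        field_simp
      rw [this]
      gcongr
    have h2 := Real.rpow_le_rpow (by positivity) h1 (show 0 ≤ 1 + α by linarith)
    rw [← Real.rpow_mul (by positivity), one_div_mul_cancel (by linarith), Real.rpow_one,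
      Real.mul_rpow (by positivity) hσ.le, div_le_iff₀ hH] at h2
    refine h2.trans (le_of_eq ?_)
    rw [hM, hτ]
    field_simp
  obtain ⟨xs, -, a, ω, hr⟩ := hu.rigid
  have hSo := hSd.1
  have hGS : ∀ᵐ x ∂(volume.restrict S), G x = crossMatrix ω := by
    refine hu.weakGrad.ae_eq_crossMatrix hSo hSΩ ?_ hr
    have hq : 1 ≤ ENNReal.ofReal p := by
      rw [← ENNReal.ofReal_one]; exact ENNReal.ofReal_le_ofReal hp
    exact ((locallyIntegrableOn_of_locallyIntegrable_restrict
      (hu.memLp_grad.locallyIntegrable hq)).mono_set hSΩ)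
  have hang := hR.angular_le hα hk hσ₀ hΩd.1 hSΩ hΩ hS hp hu.toMemW10 hr hh hσ hσ2
  set C := gapCylinder R α k h σ with hC
  have hCm : MeasurableSet C := measurableSet_gapCylinder R α k h σ
  have hCv : volume (C ∩ Ω) ≤ ENNReal.ofReal (4 * σ ^ 2 * (h + 3 * τ)) :=
    (measure_mono Set.inter_subset_left).trans (volume_gapCylinder_le R hσ.le)
  have hGC : MemLp G (ENNReal.ofReal p) (volume.restrict (C ∩ Ω)) :=
    hu.memLp_grad.mono_measure (Measure.restrict_mono Set.inter_subset_right le_rfl)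
  have hGi : IntegrableOn G (C ∩ Ω) := by
    have : IsFiniteMeasure (volume.restrict (C ∩ Ω)) :=
      ⟨by rw [Measure.restrict_apply_univ]; exact hCv.trans_lt ENNReal.ofReal_lt_top⟩
    refine hGC.integrable ?_
    rw [← ENNReal.ofReal_one]; exact ENNReal.ofReal_le_ofReal hp
  have hreal : ‖(WithLp.toLp 2 ω : E3)‖ * (σ ^ 3 * τ / 64) ≤
      4 * ((h + 3 * τ) * ∫ x in C ∩ Ω, ‖G x‖) := by
    rw [← ofReal_integral_norm_eq_lintegral_enorm hGi, ← ENNReal.ofReal_mul (by linarith),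
      ← ENNReal.ofReal_ofNat 4, ← ENNReal.ofReal_mul (by norm_num)] at hang
    exact (ENNReal.ofReal_le_ofReal_iff (by positivity)).1 hang
  set X := ∫ x in C ∩ Ω, ‖G x‖ with hX
  refine setIntegral_rpow_le_two_mul (E := C ∩ Ω ∩ closure S) (g := crossMatrix ω)
    (V := 4 * σ ^ 2 * (h + 3 * τ)) (c := 512 * (M + 3) / σ ^ 3) hp ?_ ?_
    ((hCm.inter hΩd.1.measurableSet).inter isClosed_closure.measurableSet) hGC hCv
    (by positivity) ?_ ?_ ?_
  · rw [← Set.inter_sdiff_assoc, Set.union_comm, Set.inter_union_sdiff]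
  · rw [← Set.inter_sdiff_assoc]
    exact Set.disjoint_sdiff_inter
  -- The complement of the fluid part contains `∂S`, where rigidity says nothing about `G`; it is
  -- negligible because the boundary is null.
  · have hcl : volume.restrict (closure S) = volume.restrict S :=
      Measure.restrict_congr_set (closure_ae_eq_of_null_frontier
        (volume_frontier_eq_zero hα hk hσ₀ hS))
    exact ae_mono ((Measure.restrict_mono Set.inter_subset_right le_rfl).trans hcl.le) hGS
  · refine (norm_crossMatrix_le ω).trans ?_
    have h1 : 4 * ((h + 3 * τ) * X) ≤ 4 * ((M + 3) * τ * X) := by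
      have : h + 3 * τ ≤ (M + 3) * τ := by linarith
      gcongr
    rw [div_mul_eq_mul_div, le_div_iff₀ (by positivity)]
    refine le_of_mul_le_mul_right ?_ hτ0
    linarith
  · have hpow : σ ^ (1 + α) = σ * σ ^ α := by
      rw [Real.rpow_add hσ, Real.rpow_one]
    calc 512 * (M + 3) / σ ^ 3 * (4 * σ ^ 2 * (h + 3 * τ))
        ≤ 512 * (M + 3) / σ ^ 3 * (4 * σ ^ 2 * ((M + 3) * τ)) := by
          gcongr
          linarith
      _ = 2048 * (M + 3) ^ 2 * k * σ ^ α := by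
          rw [hτ, hpow]
          field_simp
          ring
      _ ≤ 2048 * (M + 3) ^ 2 * k * κ := by gcongr
      _ = 1 / 2 := by
          rw [hκ]
          field_simp
          norm_num
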